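/- For $k\ge 1$ and a coloring $f:\mathbb N\to\{0,\dots,k-1\}$, a set $H\subseteq\mathbb N$ is $f$-homogeneous if $f$ is constant on $H$. The problem $\mathsf{RT}^1_k$ has as instances all colorings $f:\mathbb N\to\{0,\dots,k-1\}$, and as solutions of $f$ all infinite $f$-homogeneous sets. The instances of $(\mathsf{RT}^1_k)^*$ are the finite tuples $(g_0,\dots,g_{n-1})$, $n\in\mathbb N$, of instances of $\mathsf{RT}^1_k$, and the solutions of such a tuple are the tuples $(H_0,\dots,H_{n-1})$ with $H_i$ an infinite $g_i$-homogeneous set for each $i<n$; a tuple of sets is identified with its join $\bigoplus_{i<n}H_i=\{\langle i,x\rangle : i<n,\ x\in H_i\}$. A problem $\mathsf P$ is strongly omnisciently computably reducible to a problem $\mathsf Q$, written $\mathsf P\leqslant_{soc}\mathsf Q$, if for every $\mathsf P$-instance $X$ there is a $\mathsf Q$-instance $\widehat X$ (with no effectiveness requirement) such that every $\mathsf Q$-solution $\widehat Y$ of $\widehat X$ computes (in the sense of Turing reducibility) a $\mathsf P$-solution of $X$. Theorem (Liu). $\mathsf{RT}^1_3\not\leqslant_{soc}(\mathsf{RT}^1_2)^*$.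 That is, there is a coloring $f:\mathbb N\to\{0,1,2\}$ such that for every $n\in\mathbb N$ and all colorings $g_0,\dots,g_{n-1}:\mathbb N\to\{0,1\}$ there are infinite sets $H_0,\dots,H_{n-1}$, with $H_i$ $g_i$-homogeneous for each $i<n$, such that $\bigoplus_{i<n}H_i$ computes no infinite $f$-homogeneous set. -/

import Mathlib

/-- The characteristic function of a set of natural numbers, as a (total) partial function,
so that it can serve as an oracle. -/
noncomputable def charFun (A : Set ℕ) : ℕ →. ℕ := by
  classical
  exact fun n => Part.some (if n ∈ A then 1 else 0)

/-- `Computes B A`: the set `B` computes the set `A`, i.e. `A` is Turing reducible to `B`. -/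
def Computes (B A : Set ℕ) : Prop :=
  TuringReducible (charFun A) (charFun B)

/-- The effective join `Y₀ ⊕ ⋯ ⊕ Yₙ₋₁ = {⟨i, x⟩ : i < n, x ∈ Yᵢ}` of a finite tuple of sets. -/
def finJoin {n : ℕ} (Y : Fin n → Set ℕ) : Set ℕ :=
  {m | ∃ (i : Fin n) (x : ℕ), x ∈ Y i ∧ m = Nat.pair i x}

/-- A problem, given by its instances and by the solutions of each instance.
Solutions are (coded as) sets of natural numbers. -/
structure RamseyTypeProblem where
  Instance : Type
  IsSolution : Instance → Set ℕ → Prop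

namespace RamseyTypeProblem

/-- Ramsey's theorem for singletons and `k` colors: the instances are the (arbitrary) colorings
`f : ℕ → k`, and the solutions of `f` are the infinite sets `H` on which `f` is constant. -/
def RT1 (k : ℕ) : RamseyTypeProblem where
  Instance := ℕ → Fin k
  IsSolution f H := H.Infinite ∧ ∃ c : Fin k, ∀ x ∈ H, f x = c

/-- The star of a problem: the instances are the tuples `(X₀, …, Xₙ₋₁)` of instances, for
some `n : ℕ`, and the solutions are the tuples `(Y₀, …, Yₙ₋₁)`, coded by their join, such that
`Yᵢ` is a solution of `Xᵢ` for all `i < n`. -/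
def star (P : RamseyTypeProblem) : RamseyTypeProblem where
  Instance := Σ n : ℕ, Fin n → P.Instance
  IsSolution X Z := ∃ Y : Fin X.1 → Set ℕ, (∀ i, P.IsSolution (X.2 i) (Y i)) ∧ Z = finJoin Y

/-- Strong omniscient computable reducibility of `P` to `Q`: for every `P`-instance `X` there is
a `Q`-instance `X'` (not assumed to be computable from `X`) such that every `Q`-solution of `X'`
computes a `P`-solution of `X` (without the help of `X`). -/
def StronglyOmniscientlyComputablyReducible (P Q : RamseyTypeProblem) : Prop :=
  ∀ X : P.Instance, ∃ X' : Q.Instance, ∀ Z : Set ℕ, Q.IsSolution X' Z →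
    ∃ Y : Set ℕ, P.IsSolution X Y ∧ Computes Z Y

end RamseyTypeProblem

/-! The coloring `f` is chosen generic for countably many dense open sets, before `n` and `g` are
known. Given `g`, finite sets for both colors of every component are grown inside a shrinking
reservoir. A requirement names a functional and a color for every side (a choice of one color per
component) and asks for failure on just one side. If every side left some functional undefeated,
these functionals would together form a requirement that was met, a contradiction.

To meet a requirement (`Condition.exists_le_prevents`), consider the closed class `splitFree` of
pairs of a 3-coloring and a tuple of 2-colorings admitting no extension that outputs a wrongly
colored number. Either for no `N` does this class project onto all 3-colorings; then genericity of
`f` yields such an extension, compatible with `g`. Or for some `N` it does; then some smaller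
reservoir keeps a functional from outputting large numbers at all (`exists_silences`). That
reservoir depends on neither `f` nor `g`, so countably many reservoirs suffice and `f` can be
generic for them (`exists_genericFor`).

The second case rests on `exists_disagreeing_pair_of_isClosed`: two members of the class have
3-colorings that differ almost everywhere, while their 2-colorings agree infinitely often on each
reservoir. A large output compatible with both members would get the same color from both
3-colorings. Such a pair exists because a generically continuous selection cannot turn almost
everywhere distinct 3-colorings into almost opposite 2-colorings: any two 3-colorings have a third
that differs everywhere from both, which makes the two images equal rather than opposite
(`stableOn_of_dense`). -/

/-! ### Oracle computations and the use principle -/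

/-- Codes of Turing functionals. -/
inductive OracleCode : Type
  | zero | succ | left | right | oracle
  | pair (a b : OracleCode)
  | comp (a b : OracleCode)
  | prec (a b : OracleCode)
  | rfind (a : OracleCode)
  deriving Encodable

namespace OracleCode

/-- The partial function computed by a code from an oracle. -/
def eval (O : ℕ →. ℕ) : OracleCode → (ℕ →. ℕ)
  | zero => fun _ => 0
  | succ => Nat.succ
  | left => fun n => (Nat.unpair n).1
  | right => fun n => (Nat.unpair n).2
  | oracle => O
  | pair a b => fun n => (Nat.pair <$> eval O a n <*> eval O b n)
  | comp a b => fun n => eval O b n >>= eval O a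
  | prec a b => fun p =>
      let (x, n) := Nat.unpair p
      n.rec (eval O a x) fun y IH => do
        let i ← IH
        eval O b (Nat.pair x (Nat.pair y i))
  | rfind a => fun x => Nat.rfind fun n => (fun m => m = 0) <$> eval O a (Nat.pair x n)

/-- Codes are independent of the oracle and countable in number, so one functional can be run on
varying oracles and genericity can quantify over all of them. -/
theorem exists_eval_eq {O f : ℕ →. ℕ} (h : Nat.RecursiveIn {O} f) :
    ∃ e : OracleCode, eval O e = f := by
  induction h with
  | zero => exact ⟨zero, rfl⟩
  | succ => exact ⟨succ, rfl⟩
  | left => exact ⟨left, rfl⟩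
  | right => exact ⟨right, rfl⟩
  | oracle g hg => exact ⟨oracle, (Set.mem_singleton_iff.1 hg).symm⟩
  | pair _ _ iha ihb =>
    obtain ⟨a, rfl⟩ := iha
    obtain ⟨b, rfl⟩ := ihb
    exact ⟨pair a b, rfl⟩
  | comp _ _ iha ihb =>
    obtain ⟨a, rfl⟩ := iha
    obtain ⟨b, rfl⟩ := ihb
    exact ⟨comp a b, rfl⟩
  | prec _ _ iha ihb =>
    obtain ⟨a, rfl⟩ := iha
    obtain ⟨b, rfl⟩ := ihb
    exact ⟨prec a b, rfl⟩
  | rfind _ iha =>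
    obtain ⟨a, rfl⟩ := iha
    exact ⟨rfind a, rfl⟩

/-- The use principle: a converging computation queries only a finite part of its oracle. -/
theorem exists_use (O : ℕ →. ℕ) (e : OracleCode) : ∀ {m v : ℕ}, v ∈ eval O e m →
    ∃ u, ∀ O' : ℕ →. ℕ, (∀ x < u, O x = O' x) → v ∈ eval O' e m := by
  induction e with
  | zero => exact fun h => ⟨0, fun _ _ => h⟩
  | succ => exact fun h => ⟨0, fun _ _ => h⟩
  | left => exact fun h => ⟨0, fun _ _ => h⟩
  | right => exact fun h => ⟨0, fun _ _ => h⟩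
  | oracle =>
    intro m v h
    refine ⟨m + 1, fun O' hO => ?_⟩
    have := hO m (Nat.lt_succ_self m)
    simp only [eval] at h ⊢
    rwa [← this]
  | pair a b iha ihb =>
    intro m v h
    simp only [eval, Seq.seq, Part.map_eq_map, Part.mem_bind_iff, Part.mem_map_iff] at h ⊢
    obtain ⟨_, ⟨x, hx, rfl⟩, y, hy, rfl⟩ := h
    obtain ⟨u, hu⟩ := iha hx
    obtain ⟨w, hw⟩ := ihb hy
    exact ⟨max u w, fun O' hO => ⟨_, ⟨x, hu O' fun z hz => hO z (lt_max_of_lt_left hz), rfl⟩,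
      y, hw O' fun z hz => hO z (lt_max_of_lt_right hz), rfl⟩⟩
  | comp a b iha ihb =>
    intro m v h
    obtain ⟨y, hy, hv⟩ := Part.mem_bind_iff.1 h
    obtain ⟨u, hu⟩ := iha hv
    obtain ⟨w, hw⟩ := ihb hy
    exact ⟨max u w, fun O' hO => Part.mem_bind_iff.2 ⟨y, hw O' fun z hz => hO z (lt_max_of_lt_right hz),
      hu O' fun z hz => hO z (lt_max_of_lt_left hz)⟩⟩
  | prec a b iha ihb =>
    intro m v h
    simp only [eval] at h ⊢
    generalize (Nat.unpair m).1 = x at h ⊢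
    generalize (Nat.unpair m).2 = n at h ⊢
    induction n generalizing v with
    | zero => exact iha h
    | succ n ih =>
      simp only [Part.bind_eq_bind, Part.mem_bind_iff] at h ⊢
      obtain ⟨y, hy, hv⟩ := h
      obtain ⟨u, hu⟩ := ihb hv
      obtain ⟨w, hw⟩ := ih hy
      exact ⟨max u w, fun O' hO => ⟨y, hw O' fun z hz => hO z (lt_max_of_lt_right hz),
        hu O' fun z hz => hO z (lt_max_of_lt_left hz)⟩⟩
  | rfind a iha =>
    intro m v h
    obtain ⟨hv, hlt⟩ := Nat.mem_rfind.1 h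
    obtain ⟨x, hx, hx0⟩ := (Part.mem_map_iff _).1 hv
    obtain ⟨u, hu⟩ := iha hx
    have : ∀ k, ∃ w, k < v → ∀ O' : ℕ →. ℕ, (∀ x < w, O x = O' x) →
        ∃ y, y ∈ eval O' a (Nat.pair m k) ∧ decide (y = 0) = false := by
      intro k
      by_cases hk : k < v
      · obtain ⟨y, hy, hy0⟩ := (Part.mem_map_iff _).1 (hlt hk)
        obtain ⟨w, hw⟩ := iha hy
        exact ⟨w, fun _ O' hO => ⟨y, hw O' hO, hy0⟩⟩
      · exact ⟨0, fun h => absurd h hk⟩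
    choose w hw using this
    refine ⟨max u ((Finset.range v).sup w), fun O' hO => Nat.mem_rfind.2
      ⟨(Part.mem_map_iff _).2 ⟨x, hu O' fun z hz => hO z (lt_max_of_lt_left hz), hx0⟩,
        fun {k} hk => (Part.mem_map_iff _).2 ?_⟩⟩
    exact hw k hk O' fun z hz => hO z (lt_max_of_lt_right
      (hz.trans_le (Finset.le_sup (f := w) (Finset.mem_range.2 hk))))

/-- `e.Enum Y m` says that the functional coded by `e`, applied to the join of `Y`,
outputs `1` at `m`. -/
def Enum {n : ℕ} (e : OracleCode) (Y : Fin n → Set ℕ) (m : ℕ) : Prop :=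
  1 ∈ eval (charFun (finJoin Y)) e m

theorem exists_enum_iff {n : ℕ} {Y : Fin n → Set ℕ} {A : Set ℕ} (h : Computes (finJoin Y) A) :
    ∃ e : OracleCode, ∀ m, e.Enum Y m ↔ m ∈ A := by
  obtain ⟨e, he⟩ := exists_eval_eq (RecursiveIn.iff_nat.1 h)
  refine ⟨e, fun m => ?_⟩
  rw [Enum, he, charFun]
  by_cases hm : m ∈ A <;> simp [hm]

theorem mem_finJoin_iff {n : ℕ} {Y : Fin n → Set ℕ} {m : ℕ} :
    m ∈ finJoin Y ↔ ∃ s : Fin n, (s : ℕ) = m.unpair.1 ∧ m.unpair.2 ∈ Y s := by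
  constructor
  · rintro ⟨s, x, hx, rfl⟩
    exact ⟨s, by simp, by simpa using hx⟩
  · rintro ⟨s, hs, hx⟩
    exact ⟨s, _, hx, by rw [hs, Nat.pair_unpair]⟩

theorem Enum.exists_use {n : ℕ} {e : OracleCode} {Y : Fin n → Set ℕ} {m : ℕ} (h : e.Enum Y m) :
    ∃ u, ∀ Y' : Fin n → Set ℕ, (∀ s, ∀ x < u, x ∈ Y s ↔ x ∈ Y' s) → e.Enum Y' m := by
  obtain ⟨u, hu⟩ := OracleCode.exists_use _ e h
  refine ⟨u, fun Y' hY => hu _ fun x hx => ?_⟩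
  have : x ∈ finJoin Y ↔ x ∈ finJoin Y' := by
    rw [mem_finJoin_iff, mem_finJoin_iff]
    exact exists_congr fun s => and_congr_right fun _ =>
      hY s _ ((Nat.unpair_right_le x).trans_lt hx)
  by_cases hx' : x ∈ finJoin Y
  · simp [charFun, hx', this.1 hx']
  · simp [charFun, hx', mt this.2 hx']

end OracleCode

/-! ### Cylinders in sequence spaces -/

open Filter Topology

theorem exists_cylinder_of_mem_nhds {α : Type*} [TopologicalSpace α] {z : ℕ → α}
    {U : Set (ℕ → α)} (hU : U ∈ 𝓝 z) : ∃ L, ∀ w : ℕ → α, (∀ m < L, w m = z m) → w ∈ U := by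
  rw [nhds_pi, Filter.mem_pi] at hU
  obtain ⟨I, hI, t, ht, hsub⟩ := hU
  obtain ⟨L, hL⟩ := hI.bddAbove
  refine ⟨L + 1, fun w hw => hsub fun m hm => ?_⟩
  rw [hw m (Nat.lt_succ_of_le (hL hm))]
  exact mem_of_mem_nhds (ht m)

theorem cylinder_mem_nhds {α : Type*} [TopologicalSpace α] [DiscreteTopology α] (z : ℕ → α)
    (L : ℕ) : {w : ℕ → α | ∀ m < L, w m = z m} ∈ 𝓝 z :=
  (PiNat.isOpen_cylinder (fun _ => α) z L).mem_nhds (PiNat.self_mem_cylinder z L)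

/-! ### Generically continuous leftmost selections -/

section Selection

variable {A : Type*}

/-- The sections of `Q` at `h` that extend the string `τ` are nonempty. -/
def ExtendsIn (Q : Set (A × (ℕ → Bool))) (τ : List Bool) : Set A :=
  {h | ∃ z, (h, z) ∈ Q ∧ ∀ i, ∀ hi : i < τ.length, z i = τ[i]}

/-- Projection along the compact Cantor space is a closed map. -/
theorem isClosed_extendsIn [TopologicalSpace A] {Q : Set (A × (ℕ → Bool))} (hQ : IsClosed Q)
    (τ : List Bool) : IsClosed (ExtendsIn Q τ) := by
  have h1 : IsClosed {p : A × (ℕ → Bool) | ∀ i, ∀ hi : i < τ.length, p.2 i = τ[i]} := by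
    simp only [Set.ofPred_forall]
    exact isClosed_iInter fun i => isClosed_iInter fun hi =>
      isClosed_eq ((continuous_apply i).comp continuous_snd) continuous_const
  have h2 : ExtendsIn Q τ =
      Prod.fst '' (Q ∩ {p : A × (ℕ → Bool) | ∀ i, ∀ hi : i < τ.length, p.2 i = τ[i]}) := by
    ext h
    constructor
    · rintro ⟨z, hz, hτ⟩
      exact ⟨(h, z), ⟨hz, hτ⟩, rfl⟩
    · rintro ⟨⟨_, z⟩, ⟨hz, hτ⟩, rfl⟩
      exact ⟨z, hz, hτ⟩
  rw [h2]
  exact isClosedMap_fst_of_compactSpace _ (hQ.inter h1)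

open Classical in
/-- The initial segment of length `k` of the leftmost element of the section of `Q` at `h`. -/
noncomputable def leftmostPrefix (Q : Set (A × (ℕ → Bool))) (h : A) : ℕ → List Bool
  | 0 => []
  | k + 1 => leftmostPrefix Q h k ++
      [if h ∈ ExtendsIn Q (leftmostPrefix Q h k ++ [false]) then false else true]

theorem length_leftmostPrefix (Q : Set (A × (ℕ → Bool))) (h : A) (k : ℕ) :
    (leftmostPrefix Q h k).length = k := by
  induction k with
  | zero => rfl
  | succ k ih => simp [leftmostPrefix, ih]

theorem mem_extendsIn_leftmostPrefix {Q : Set (A × (ℕ → Bool))} {h : A} (hh : ∃ z, (h, z) ∈ Q)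
    (k : ℕ) : h ∈ ExtendsIn Q (leftmostPrefix Q h k) := by
  induction k with
  | zero =>
    obtain ⟨z, hz⟩ := hh
    exact ⟨z, hz, fun i hi => absurd hi (Nat.not_lt_zero i)⟩
  | succ k ih =>
    rw [leftmostPrefix]
    split_ifs with hf
    · exact hf
    · obtain ⟨z, hz, hτ⟩ := ih
      refine ⟨z, hz, fun i hi => ?_⟩
      rw [List.getElem_append]
      split_ifs with hi'
      · exact hτ i hi'
      · have hik : i = (leftmostPrefix Q h k).length := by
          simp only [List.length_append, List.length_singleton] at hi
          omega
        by_contra hne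
        refine hf ⟨z, hz, fun j hj => ?_⟩
        rw [List.getElem_append]
        split_ifs with hj'
        · exact hτ j hj'
        · have hjk : j = i := by
            simp only [List.length_append, List.length_singleton] at hj
            omega
          subst hjk
          simpa using hne

/-- A compact-valued closed relation has a selection that is continuous at all points of a
residual set. -/
theorem exists_selection [TopologicalSpace A] {Q : Set (A × (ℕ → Bool))} (hQ : IsClosed Q)
    (hfull : ∀ h, ∃ z, (h, z) ∈ Q) :
    ∃ Γ : A → ℕ → Bool, (∀ h, (h, Γ h) ∈ Q) ∧ {h | ContinuousAt Γ h} ∈ residual A := by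
  set Γ : A → ℕ → Bool := fun h k => (leftmostPrefix Q h (k + 1)).getD k false with hΓ
  have hpre : ∀ h k i (hi : i < (leftmostPrefix Q h k).length),
      (leftmostPrefix Q h k)[i] = Γ h i := by
    intro h k
    induction k with
    | zero => exact fun i hi => absurd hi (Nat.not_lt_zero i)
    | succ k ih =>
      intro i hi
      rcases Nat.lt_or_ge i k with hik | hik
      · rw [← ih i (by rwa [length_leftmostPrefix])]
        simp only [leftmostPrefix]
        rw [List.getElem_append_left]
      · have : i = k := by
          rw [length_leftmostPrefix] at hi
          omega
        subst this
        rw [hΓ]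
        simp only
        rw [List.getD_eq_getElem]
  refine ⟨Γ, fun h => ?_, ?_⟩
  · choose z hz hτ using mem_extendsIn_leftmostPrefix (hfull h)
    refine hQ.mem_of_tendsto (b := atTop) (f := fun k => (h, z k)) ?_
      (Eventually.of_forall fun k => hz k)
    refine tendsto_const_nhds.prodMk_nhds (tendsto_pi_nhds.2 fun i => ?_)
    refine tendsto_const_nhds.congr' ?_
    filter_upwards [eventually_gt_atTop i] with k hk
    rw [hτ k i (by rwa [length_leftmostPrefix]), hpre]
  -- Frontiers of closed sets are nowhere dense, and there are countably many strings. Off all these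
  -- frontiers every decision of the leftmost path is locally constant.
  · have hC : (⋂ τ : List Bool, (frontier (ExtendsIn Q τ))ᶜ) ∈ residual A := by
      refine countable_iInter_mem.2 fun τ => residual_of_dense_open isClosed_frontier.isOpen_compl ?_
      rw [← interior_eq_empty_iff_dense_compl]
      exact interior_frontier (isClosed_extendsIn hQ τ)
    refine mem_of_superset hC fun h hh => ?_
    rw [Set.mem_iInter] at hh
    have hloc : ∀ k, ∀ᶠ h' in 𝓝 h, leftmostPrefix Q h' k = leftmostPrefix Q h k := by
      intro k
      induction k with
      | zero => exact Eventually.of_forall fun _ => rfl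
      | succ k ih =>
        have hev : ∀ᶠ h' in 𝓝 h, (h' ∈ ExtendsIn Q (leftmostPrefix Q h k ++ [false]) ↔
            h ∈ ExtendsIn Q (leftmostPrefix Q h k ++ [false])) := by
          have hcl := isClosed_extendsIn hQ (leftmostPrefix Q h k ++ [false])
          have hfr := hh (leftmostPrefix Q h k ++ [false])
          by_cases hm : h ∈ ExtendsIn Q (leftmostPrefix Q h k ++ [false])
          · have : h ∈ interior (ExtendsIn Q (leftmostPrefix Q h k ++ [false])) := by
              by_contra hi
              exact hfr ⟨subset_closure hm, hi⟩
            filter_upwards [mem_interior_iff_mem_nhds.1 this] with h' hh'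
            exact iff_of_true hh' hm
          · filter_upwards [hcl.isOpen_compl.mem_nhds hm] with h' hh'
            exact iff_of_false hh' hm
        filter_upwards [ih, hev] with h' h1 h2
        by_cases hm : h ∈ ExtendsIn Q (leftmostPrefix Q h k ++ [false])
        · simp [leftmostPrefix, h1, h2.2 hm, hm]
        · simp [leftmostPrefix, h1, mt h2.1 hm, hm]
    refine tendsto_pi_nhds.2 fun k => ?_
    refine tendsto_const_nhds.congr' ?_
    filter_upwards [hloc (k + 1)] with h' hh'
    simp only [hΓ, hh']

end Selection

/-! ### Disagreeing 3-colorings with agreeing 2-colorings -/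

section Pairs

/-- Pairs of distinct colors. -/
abbrev DistinctPair : Type := {p : Fin 3 × Fin 3 // p.1 ≠ p.2}

/-- The coloring given by `ρ` below `l` and by the letters of `z` elsewhere. -/
def splice (φ : DistinctPair → Fin 3) (ρ : ℕ → Fin 3) (l : ℕ) (z : ℕ → DistinctPair) :
    ℕ → Fin 3 :=
  fun m => if m < l then ρ m else φ (z m)

theorem splice_eq_piMap (φ : DistinctPair → Fin 3) (ρ : ℕ → Fin 3) (l : ℕ) :
    splice φ ρ l = Pi.map (fun m => if m < l then fun _ => ρ m else φ) := by
  funext z m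
  by_cases hm : m < l <;> simp [splice, hm]

/-- The splice is continuous and open, since all but finitely many of its coordinate maps are
surjective. Hence both projections of a generic sequence of pairs are generic, even after a
prescribed beginning. -/
theorem tendsto_splice_residual {φ : DistinctPair → Fin 3} (hφ : Function.Surjective φ)
    (ρ : ℕ → Fin 3) (l : ℕ) :
    Tendsto (splice φ ρ l) (residual _) (residual _) := by
  refine tendsto_residual_of_isOpenMap ?_ ?_
  · refine continuous_pi fun m => ?_
    by_cases hm : m < l
    · simpa [splice, hm] using continuous_const
    · simp only [splice, hm, if_false]
      exact continuous_of_discreteTopology.comp (continuous_apply m)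
  · rw [splice_eq_piMap]
    refine IsOpenMap.piMap (fun m U _ => isOpen_discrete _) ?_
    rw [Nat.cofinite_eq_atTop]
    filter_upwards [eventually_ge_atTop l] with m hm
    simpa [Nat.not_lt.2 hm] using hφ

/-- Values of `Γ s` on `X s` do not depend, beyond some point and for the colorings in `C` that
agree with `ρ` below `l`, on the coloring. -/
def StableOn {ι : Type*} (C : Set (ℕ → Fin 3)) (Γ : (ℕ → Fin 3) → ι → ℕ → Bool) (X : ι → Set ℕ)
    (ρ : ℕ → Fin 3) (l : ℕ) (s : ι) : Prop :=
  ∃ N, ∀ h ∈ C, ∀ h' ∈ C, (∀ m < l, h m = ρ m) → (∀ m < l, h' m = ρ m) →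
    ∀ x ∈ X s, N ≤ x → Γ h s x = Γ h' s x

/-- If opposite values of `Γ s` are dense among the pairs in a cylinder, then `Γ s` is stable on
the second projection of this cylinder. -/
theorem stableOn_of_dense {ι : Type*} {C : Set (ℕ → Fin 3)}
    {Γ : (ℕ → Fin 3) → ι → ℕ → Bool}
    (hΓ : ∀ h ∈ C, ∀ s x, ∀ᶠ h' in 𝓝 h, Γ h' s x = Γ h s x) {X : ι → Set ℕ}
    {T : Set (ℕ → DistinctPair)} {p₀ p₁ : (ℕ → DistinctPair) → ℕ → Fin 3} {l L N : ℕ} {s : ι}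
    (hlL : l ≤ L)
    (hp₀ : ∀ z m, l ≤ m → p₀ z m = (z m).1.1) (hp₁ : ∀ z m, l ≤ m → p₁ z m = (z m).1.2)
    (hp₀' : ∀ z z' m, m < l → p₀ z m = p₀ z' m) (hp₁' : ∀ z z' m, m < l → p₁ z m = p₁ z' m)
    (hT : ∀ z ∈ T, p₀ z ∈ C ∧ p₁ z ∈ C ∧ ∀ x ∈ X s, N ≤ x → Γ (p₀ z) s x ≠ Γ (p₁ z) s x)
    {z : ℕ → DistinctPair}
    (hz : ∀ (w : ℕ → DistinctPair) (M : ℕ), (∀ m < L, w m = z m) → ∃ w' ∈ T, ∀ m < M, w' m = w m) :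
    StableOn C Γ X (p₁ z) L s := by
  have ext₀ : ∀ w w' m, w m = w' m → p₀ w m = p₀ w' m := by
    intro w w' m hw
    rcases Nat.lt_or_ge m l with hm | hm
    · exact hp₀' _ _ m hm
    · rw [hp₀ _ m hm, hp₀ _ m hm, hw]
  have ext₁ : ∀ w w' m, w m = w' m → p₁ w m = p₁ w' m := by
    intro w w' m hw
    rcases Nat.lt_or_ge m l with hm | hm
    · exact hp₁' _ _ m hm
    · rw [hp₁ _ m hm, hp₁ _ m hm, hw]
  refine ⟨N, fun h hh h' hh' hρ hρ' x hx hNx => ?_⟩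
  obtain ⟨M₀, hM₀⟩ := exists_cylinder_of_mem_nhds (hΓ h hh s x)
  obtain ⟨M₁, hM₁⟩ := exists_cylinder_of_mem_nhds (hΓ h' hh' s x)
  set M := max L (max M₀ M₁) with hM
  have hLM : L ≤ M := le_max_left _ _
  have hM₀M : M₀ ≤ M := (le_max_left _ _).trans (le_max_right _ _)
  have hM₁M : M₁ ≤ M := (le_max_right _ _).trans (le_max_right _ _)
  -- This is where three colors are needed: `f` avoids `h` and `h'` simultaneously.
  have third : ∀ a b : Fin 3, ∃ c, c ≠ a ∧ c ≠ b := by decide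
  choose f hf hf' using fun m => third (h m) (h' m)
  -- `w₂` approximates the pair `(f, h)` and `w₃` below the pair `(f, h')`. Both images under `p₁`
  -- are opposite at `x` to a common value, hence equal.
  obtain ⟨w₂, hw₂T, hw₂⟩ := hz (fun m => if m < L then z m else ⟨(f m, h m), hf m⟩) M
    fun m hm => if_pos hm
  obtain ⟨hw₂C, -, hw₂ne⟩ := hT w₂ hw₂T
  have e₁ : Γ (p₁ w₂) s x = Γ h s x := by
    refine hM₀ _ fun m hm => ?_
    have hmM := hw₂ m (hm.trans_le hM₀M)
    rcases Nat.lt_or_ge m L with hmL | hmL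
    · rw [if_pos hmL] at hmM
      rw [ext₁ _ _ m hmM, hρ m hmL]
    · rw [if_neg hmL.not_gt] at hmM
      rw [hp₁ _ m (hlL.trans hmL), hmM]
  obtain ⟨M₂, hM₂⟩ := exists_cylinder_of_mem_nhds (hΓ _ hw₂C s x)
  -- Continuity at `p₀ w₂` may need more than `M` coordinates, so past `M` the target follows `w₂`
  -- itself.
  obtain ⟨w₃, hw₃T, hw₃⟩ := hz (fun m => if m < L then z m else if m < M then
    ⟨(f m, h' m), hf' m⟩ else w₂ m) (max M M₂) fun m hm => if_pos hm
  obtain ⟨-, -, hw₃ne⟩ := hT w₃ hw₃T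
  have e₂ : Γ (p₀ w₃) s x = Γ (p₀ w₂) s x := by
    refine hM₂ _ fun m hm => ?_
    have hm₃ := hw₃ m (hm.trans_le (le_max_right _ _))
    rcases Nat.lt_or_ge m L with hmL | hmL
    · have hm₂ := hw₂ m (hmL.trans_le hLM)
      rw [if_pos hmL] at hm₃ hm₂
      exact ext₀ _ _ m (hm₃.trans hm₂.symm)
    · rw [if_neg hmL.not_gt] at hm₃
      rcases Nat.lt_or_ge m M with hmM | hmM
      · have hm₂ := hw₂ m hmM
        rw [if_neg hmL.not_gt] at hm₂
        rw [if_pos hmM] at hm₃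
        rw [hp₀ _ m (hlL.trans hmL), hp₀ _ m (hlL.trans hmL), hm₂, hm₃]
      · rw [if_neg hmM.not_gt] at hm₃
        exact ext₀ _ _ m hm₃
  have e₃ : Γ (p₁ w₃) s x = Γ h' s x := by
    refine hM₁ _ fun m hm => ?_
    have hm₃ := hw₃ m (hm.trans_le (hM₁M.trans (le_max_left _ _)))
    rcases Nat.lt_or_ge m L with hmL | hmL
    · rw [if_pos hmL] at hm₃
      rw [ext₁ _ _ m hm₃, hρ' m hmL]
    · rw [if_neg hmL.not_gt, if_pos (hm.trans_le hM₁M)] at hm₃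
      rw [hp₁ _ m (hlL.trans hmL), hm₃]
  have n₂ := hw₂ne x hx hNx
  have n₃ := hw₃ne x hx hNx
  rw [e₁] at n₂
  rw [e₂, e₃] at n₃
  exact (Bool.eq_not.2 n₂.symm).trans (Bool.eq_not.2 n₃.symm).symm

/-- Among colorings in a residual set, some two disagree almost everywhere although each of
their finitely many (generically continuous) images agree infinitely often. -/
theorem exists_disagreeing_pair {n : ℕ} {C : Set (ℕ → Fin 3)} (hC : C ∈ residual _)
    {Γ : (ℕ → Fin 3) → Fin n → ℕ → Bool}
    (hΓ : ∀ h ∈ C, ∀ s x, ∀ᶠ h' in 𝓝 h, Γ h' s x = Γ h s x) {X : Fin n → Set ℕ}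
    (hX : ∀ s, (X s).Infinite) :
    ∃ h₀ ∈ C, ∃ h₁ ∈ C, (∃ N, ∀ m ≥ N, h₀ m ≠ h₁ m) ∧
      ∀ s, {x ∈ X s | Γ h₀ s x = Γ h₁ s x}.Infinite := by
  by_contra hcon
  push Not at hcon
  -- Under the contrary assumption stable components accumulate, which is impossible once there are
  -- more than `n`.
  have step : ∀ (S : Finset (Fin n)) (ρ : ℕ → Fin 3) (l : ℕ), (∀ s ∈ S, StableOn C Γ X ρ l s) →
      ∃ s ∉ S, ∃ ρ' l', ∀ t ∈ insert s S, StableOn C Γ X ρ' l' t := by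
    intro S ρ l hS
    set p₀ := splice (fun p => p.1.1) ρ l with hp₀
    set p₁ := splice (fun p => p.1.2) ρ l with hp₁
    have sur₀ : Function.Surjective (fun p : DistinctPair => p.1.1) := by decide
    have sur₁ : Function.Surjective (fun p : DistinctPair => p.1.2) := by decide
    have q₀ : ∀ z m, l ≤ m → p₀ z m = (z m).1.1 := fun z m hm => if_neg hm.not_gt
    have q₁ : ∀ z m, l ≤ m → p₁ z m = (z m).1.2 := fun z m hm => if_neg hm.not_gt
    have r₀ : ∀ z m, m < l → p₀ z m = ρ m := fun z m hm => if_pos hm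
    have r₁ : ∀ z m, m < l → p₁ z m = ρ m := fun z m hm => if_pos hm
    set T : Fin n × ℕ → Set (ℕ → DistinctPair) := fun i =>
      {z | p₀ z ∈ C ∧ p₁ z ∈ C ∧ ∀ x ∈ X i.1, i.2 ≤ x → Γ (p₀ z) i.1 x ≠ Γ (p₁ z) i.1 x} with hT
    have hR : {z | p₀ z ∈ C ∧ p₁ z ∈ C} ∈ residual (ℕ → DistinctPair) :=
      inter_mem (tendsto_splice_residual sur₀ ρ l hC) (tendsto_splice_residual sur₁ ρ l hC)
    have hcov : {z | p₀ z ∈ C ∧ p₁ z ∈ C} ⊆ ⋃ i, T i := by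
      rintro z ⟨hz₀, hz₁⟩
      obtain ⟨s, hs⟩ := hcon _ hz₀ _ hz₁
        ⟨l, fun m hm => by rw [q₀ z m hm, q₁ z m hm]; exact (z m).2⟩
      obtain ⟨N, hN⟩ := hs.bddAbove
      refine Set.mem_iUnion.2 ⟨(s, N + 1), hz₀, hz₁, fun x hx hNx he => ?_⟩
      exact absurd (hN ⟨hx, he⟩) (by simpa using hNx)
    -- By Baire, a single component and a single threshold account for opposite values densely in
    -- some cylinder.
    obtain ⟨i, hi⟩ : ∃ i, ¬ IsNowhereDense (T i) := by
      by_contra hno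
      push Not at hno
      have hm : IsMeagre (⋃ i, T i) := isMeagre_iUnion fun i => (hno i).isMeagre
      have : (⋃ i, T i) ∩ (⋃ i, T i)ᶜ ∈ residual (ℕ → DistinctPair) :=
        inter_mem (mem_of_superset hR hcov) hm
      rw [Set.inter_compl_self] at this
      have : (∅ : Set (ℕ → DistinctPair)).Nonempty :=
        @Dense.nonempty _ _ _ ⟨fun _ => ⟨(0, 1), by decide⟩⟩ (dense_of_mem_residual this)
      exact Set.not_nonempty_empty this
    obtain ⟨z, hz⟩ := Set.nonempty_iff_ne_empty.2 hi
    obtain ⟨L₀, hL₀⟩ := exists_cylinder_of_mem_nhds (mem_interior_iff_mem_nhds.1 hz)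
    set L := max l L₀
    have hlL : l ≤ L := le_max_left _ _
    have hdense : ∀ (w : ℕ → DistinctPair) (M : ℕ), (∀ m < L, w m = z m) → ∃ w' ∈ T i, ∀ m < M, w' m = w m := by
      intro w M hw
      have hcl := hL₀ w fun m hm => hw m (hm.trans_le (le_max_right _ _))
      obtain ⟨w', hw', hT'⟩ := mem_closure_iff_nhds.1 hcl _ (cylinder_mem_nhds w M)
      exact ⟨w', hT', hw'⟩
    -- A component already stable takes equal values far out in its infinite `X i.1`, so it cannot
    -- be the opposite one.
    have hiS : i.1 ∉ S := by
      intro his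
      obtain ⟨N, hN⟩ := hS _ his
      obtain ⟨w, ⟨hw₀, hw₁, hne⟩, -⟩ := hdense z 0 fun _ _ => rfl
      obtain ⟨x, hx, hlt⟩ := (hX i.1).exists_gt (max N i.2)
      exact hne x hx ((le_max_right _ _).trans hlt.le)
        (hN _ hw₀ _ hw₁ (r₀ w) (r₁ w) x hx ((le_max_left _ _).trans hlt.le))
    refine ⟨i.1, hiS, p₁ z, L, fun t ht => ?_⟩
    rcases Finset.mem_insert.1 ht with rfl | ht
    · exact stableOn_of_dense hΓ hlL q₀ q₁ (fun z z' m hm => by rw [r₀ z m hm, r₀ z' m hm])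
        (fun z z' m hm => by rw [r₁ z m hm, r₁ z' m hm]) (fun z hz => hz) hdense
    · obtain ⟨N, hN⟩ := hS t ht
      refine ⟨N, fun h hh h' hh' hρ hρ' => hN h hh h' hh' (fun m hm => ?_) (fun m hm => ?_)⟩
      · rw [hρ m (hm.trans_le hlL), r₁ z m hm]
      · rw [hρ' m (hm.trans_le hlL), r₁ z m hm]
  have all : ∀ k : ℕ, ∃ S : Finset (Fin n), S.card = k ∧
      ∃ ρ l, ∀ s ∈ S, StableOn C Γ X ρ l s := by
    intro k
    induction k with
    | zero => exact ⟨∅, rfl, fun _ => 0, 0, fun s hs => absurd hs (Finset.notMem_empty s)⟩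
    | succ k ih =>
      obtain ⟨S, hS, ρ, l, hst⟩ := ih
      obtain ⟨s, hs, ρ', l', hst'⟩ := step S ρ l hst
      exact ⟨insert s S, by rw [Finset.card_insert_of_notMem hs, hS], ρ', l', hst'⟩
  obtain ⟨S, hS, -⟩ := all (n + 1)
  have := S.card_le_univ
  rw [hS, Fintype.card_fin] at this
  omega

/-- A closed class of pairs consisting of a `3`-coloring and a tuple of `2`-colorings that
projects onto all `3`-colorings has two members whose `3`-colorings disagree almost everywhere
while corresponding `2`-colorings agree infinitely often on the given infinite sets. -/
theorem exists_disagreeing_pair_of_isClosed {n : ℕ} {Q : Set ((ℕ → Fin 3) × (Fin n → ℕ → Bool))}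
    (hQ : IsClosed Q) (hfull : ∀ h, ∃ y, (h, y) ∈ Q) {X : Fin n → Set ℕ}
    (hX : ∀ s, (X s).Infinite) :
    ∃ h₀ y₀ h₁ y₁, (h₀, y₀) ∈ Q ∧ (h₁, y₁) ∈ Q ∧ (∃ N, ∀ m ≥ N, h₀ m ≠ h₁ m) ∧
      ∀ s, {x ∈ X s | y₀ s x = y₁ s x}.Infinite := by
  let dec : (ℕ → Bool) → Fin n → ℕ → Bool := fun z s x => z (Nat.pair s x)
  have hdec : Continuous dec :=
    continuous_pi fun s => continuous_pi fun x => continuous_apply (Nat.pair s x)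
  have hsur : ∀ y, ∃ z, dec z = y := by
    intro y
    refine ⟨fun k => if hk : k.unpair.1 < n then y ⟨_, hk⟩ k.unpair.2 else false, ?_⟩
    funext s x
    simp [dec]
  obtain ⟨Γ, hΓQ, hΓ⟩ := exists_selection (Q := {p : (ℕ → Fin 3) × (ℕ → Bool) | (p.1, dec p.2) ∈ Q})
    (hQ.preimage (continuous_fst.prodMk (hdec.comp continuous_snd))) (by
      intro h
      obtain ⟨y, hy⟩ := hfull h
      obtain ⟨z, rfl⟩ := hsur y
      exact ⟨z, hy⟩)
  obtain ⟨h₀, -, h₁, -, hN, hinf⟩ := exists_disagreeing_pair (Γ := fun h => dec (Γ h)) hΓ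
    (fun h hh s x => by
      have hc : ContinuousAt (fun h => Γ h (Nat.pair s x)) h :=
        (continuous_apply (Nat.pair (s : ℕ) x)).continuousAt.comp hh
      exact hc.eventually_mem ((isOpen_discrete {Γ h (Nat.pair s x)}).mem_nhds rfl)) hX
  exact ⟨h₀, _, h₁, _, hΓQ h₀, hΓQ h₁, hN, hinf⟩

end Pairs

/-! ### Countable closure and generic sequences -/

/-- A countable closure under choices of witnesses for countably many binary relations. -/
theorem exists_countable_closed {α D : Type*} [Countable D] (P : D → α → α → Prop) (x₀ : α) :
    ∃ M : Set α, M.Countable ∧ x₀ ∈ M ∧ ∀ d, ∀ x ∈ M, (∃ y, P d x y) → ∃ y ∈ M, P d x y := by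
  classical
  choose next hnext using fun (d : D) (x : α) =>
    show ∃ y, (∃ y, P d x y) → P d x y from by
      by_cases h : ∃ y, P d x y
      · exact ⟨h.choose, fun _ => h.choose_spec⟩
      · exact ⟨x, fun h' => absurd h' h⟩
  refine ⟨Set.range fun L : List D => L.foldr next x₀, Set.countable_range _, ⟨[], rfl⟩, ?_⟩
  rintro d _ ⟨L, rfl⟩ h
  exact ⟨_, ⟨d :: L, rfl⟩, hnext d _ h⟩

/-- A monotone sequence meeting countably many cofinal sets. -/
theorem exists_monotone_meeting {P ι : Type*} [Preorder P] [Countable ι] (p : P)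
    (D : ι → Set P) (hD : ∀ i x, ∃ y ∈ D i, x ≤ y) :
    ∃ c : ℕ → P, Monotone c ∧ ∀ i, ∃ k, c k ∈ D i := by
  have := Encodable.ofCountable ι
  let 𝒟 : ι → Order.Cofinal P := fun i => ⟨D i, fun x => hD i x⟩
  exact ⟨Order.sequenceOfCofinals p 𝒟, Order.sequenceOfCofinals.monotone p 𝒟,
    fun i => ⟨_, Order.sequenceOfCofinals.encode_mem p 𝒟 i⟩⟩

/-! ### Splitting, silencing and the generic coloring -/

/-- Finite initial parts for both colors of every component, the components whose color is
decided, and for each side a functional together with the color it is supposed to produce. -/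
abbrev Datum (n : ℕ) : Type :=
  (Fin n → Bool → Finset ℕ) × (Fin n → Option Bool) × ((Fin n → Bool) → OracleCode × Fin 3)

/-- The side `a` respects the decided components. -/
def Compatible {n : ℕ} (b : Fin n → Option Bool) (a : Fin n → Bool) : Prop :=
  ∀ s β, b s = some β → a s = β

/-- The pairs of a `3`-coloring and a tuple of `2`-colorings for which no homogeneous finite
extension within `X` produces, at or beyond `N`, an element of an unwanted color. -/
def splitFree {n : ℕ} (X : Fin n → Set ℕ) (d : Datum n) (N : ℕ) :
    Set ((ℕ → Fin 3) × (Fin n → ℕ → Bool)) :=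
  {p | (∀ s β, d.2.1 s = some β → ∀ x, p.2 s x = β) ∧
    ∀ a, Compatible d.2.1 a → ∀ E : Fin n → Finset ℕ, ∀ m ≥ N,
      (d.2.2 a).1.Enum (fun s => (d.1 s (a s) : Set ℕ) ∪ E s) m →
      (∀ s, ∀ x ∈ E s, x ∈ X s ∧ p.2 s x = a s) → p.1 m = (d.2.2 a).2}

theorem isClosed_splitFree {n : ℕ} (X : Fin n → Set ℕ) (d : Datum n) (N : ℕ) :
    IsClosed (splitFree X d N) := by
  have hev : ∀ s x, Continuous fun p : (ℕ → Fin 3) × (Fin n → ℕ → Bool) => p.2 s x :=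
    fun s x => (continuous_apply x).comp ((continuous_apply s).comp continuous_snd)
  simp only [splitFree, Set.ofPred_and, Set.ofPred_forall]
  refine IsClosed.inter ?_ ?_
  · exact isClosed_iInter fun s => isClosed_iInter fun β => isClosed_iInter fun _ =>
      isClosed_iInter fun x => isClosed_eq (hev s x) continuous_const
  · refine isClosed_iInter fun a => isClosed_iInter fun _ => isClosed_iInter fun E =>
      isClosed_iInter fun m => isClosed_iInter fun _ => isClosed_iInter fun _ => ?_
    refine isClosed_imp ?_ (isClosed_eq ((continuous_apply m).comp continuous_fst) continuous_const)
    simp only [Set.ofPred_forall]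
    refine isOpen_iInter_of_finite fun s => isOpen_biInter_finset fun x _ => ?_
    exact isOpen_const.and ((isOpen_discrete {a s}).preimage (hev s x))

theorem splitFree_mono {n : ℕ} (X : Fin n → Set ℕ) (d : Datum n) {N : ℕ} {h h' : ℕ → Fin 3}
    (hh : ∀ m ≥ N, h m = h' m) {y : Fin n → ℕ → Bool} (hy : (h, y) ∈ splitFree X d 0) :
    (h', y) ∈ splitFree X d N :=
  ⟨hy.1, fun a ha E m hm he hE => (hh m hm).symm.trans (hy.2 a ha E m (Nat.zero_le m) he hE)⟩

/-- The `3`-colorings `h` such that every tuple of `2`-colorings admits a splitting extension. -/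
def splitSet {n : ℕ} (X : Fin n → Set ℕ) (d : Datum n) : Set (ℕ → Fin 3) :=
  {h | ¬ ∃ y, (h, y) ∈ splitFree X d 0}

theorem isOpen_splitSet {n : ℕ} (X : Fin n → Set ℕ) (d : Datum n) : IsOpen (splitSet X d) := by
  have : splitSet X d = (Prod.fst '' splitFree X d 0)ᶜ := by
    ext h
    simp [splitSet]
  rw [this]
  exact (isClosedMap_fst_of_compactSpace _ (isClosed_splitFree X d 0)).isOpen_compl

/-- Splitting beyond `L` is unaffected by the colors below `L`, so a coloring outside the projection
can be given any initial segment. -/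
theorem dense_splitSet {n : ℕ} (X : Fin n → Set ℕ) (d : Datum n)
    (hN : ∀ N, ¬ ∀ h, ∃ y, (h, y) ∈ splitFree X d N) : Dense (splitSet X d) := by
  intro h
  refine mem_closure_iff_nhds.2 fun U hU => ?_
  obtain ⟨L, hL⟩ := exists_cylinder_of_mem_nhds hU
  have := hN L
  push Not at this
  obtain ⟨h', hh'⟩ := this
  refine ⟨fun m => if m < L then h m else h' m, hL _ fun m hm => if_pos hm, ?_⟩
  rintro ⟨y, hy⟩
  exact hh' y (splitFree_mono X d (fun m hm => if_neg hm.not_gt) hy)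

/-- Tuples of infinite sets. -/
abbrev Reservoir (n : ℕ) : Type := {X : Fin n → Set ℕ // ∀ s, (X s).Infinite}

/-- Extensions of `F` within `Y` produce no elements beyond some point, on some side. -/
def Silences {n : ℕ} (d : Datum n) (Y : Fin n → Set ℕ) : Prop :=
  ∃ a, Compatible d.2.1 a ∧ ∃ N, ∀ E : Fin n → Finset ℕ, (∀ s, ∀ x ∈ E s, x ∈ Y s) → ∀ m ≥ N,
    ¬ (d.2.2 a).1.Enum (fun s => (d.1 s (a s) : Set ℕ) ∪ E s) m

/-- On the places where two 2-colorings agree, pigeonhole picks one color per component. An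
extension within them is homogeneous for both tuples, so a large output would have the same color
under two 3-colorings that differ there. -/
theorem exists_silences {n : ℕ} (X : Reservoir n) (d : Datum n) {N : ℕ}
    (hfull : ∀ h, ∃ y, (h, y) ∈ splitFree X.1 d N) :
    ∃ Y : Reservoir n, (∀ s, Y.1 s ⊆ X.1 s) ∧ Silences d Y.1 := by
  obtain ⟨h₀, y₀, h₁, y₁, hy₀, hy₁, ⟨N', hN'⟩, hinf⟩ :=
    exists_disagreeing_pair_of_isClosed (isClosed_splitFree X.1 d N) hfull X.2
  have hcol : ∀ s, ∃ β, {x ∈ X.1 s | y₀ s x = β ∧ y₁ s x = β}.Infinite := by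
    intro s
    have hu : {x ∈ X.1 s | y₀ s x = y₁ s x} ⊆ {x ∈ X.1 s | y₀ s x = true ∧ y₁ s x = true} ∪
        {x ∈ X.1 s | y₀ s x = false ∧ y₁ s x = false} := by
      rintro x ⟨hx, he⟩
      cases hβ : y₀ s x
      · exact Or.inr ⟨hx, hβ, he ▸ hβ⟩
      · exact Or.inl ⟨hx, hβ, he ▸ hβ⟩
    rcases Set.infinite_union.1 ((hinf s).mono hu) with h | h
    · exact ⟨true, h⟩
    · exact ⟨false, h⟩
  choose a ha using hcol
  have hcomp : Compatible d.2.1 a := by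
    intro s β hβ
    obtain ⟨x, -, hx, -⟩ := (ha s).nonempty
    rw [← hx]
    exact hy₀.1 s β hβ x
  refine ⟨⟨fun s => {x ∈ X.1 s | y₀ s x = a s ∧ y₁ s x = a s}, ha⟩, fun s x hx => hx.1,
    a, hcomp, max N N', fun E hE m hm he => ?_⟩
  have hmN := (le_max_left _ _).trans hm
  refine hN' m ((le_max_right _ _).trans hm) ?_
  exact (hy₀.2 a hcomp E m hmN he fun s x hx => ⟨(hE s x hx).1, (hE s x hx).2.1⟩).trans
    (hy₁.2 a hcomp E m hmN he fun s x hx => ⟨(hE s x hx).1, (hE s x hx).2.2⟩).symm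

/-- A family of reservoirs closed under tails and under silencing. -/
structure IsClosedFamily {n : ℕ} (M : Set (Reservoir n)) : Prop where
  nonempty : M.Nonempty
  tail : ∀ X ∈ M, ∀ K, ∃ Y ∈ M, ∀ s, Y.1 s = X.1 s ∩ Set.Ici K
  silence : ∀ X ∈ M, ∀ d, (∃ N, ∀ h, ∃ y, (h, y) ∈ splitFree X.1 d N) →
    ∃ Y ∈ M, (∀ s, Y.1 s ⊆ X.1 s) ∧ Silences d Y.1

theorem exists_isClosedFamily (n : ℕ) : ∃ M : Set (Reservoir n), M.Countable ∧ IsClosedFamily M := by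
  obtain ⟨M, hM, h₀, hcl⟩ := exists_countable_closed (D := ℕ ⊕ Datum n)
    (fun i (X Y : Reservoir n) => Sum.elim (fun K => ∀ s, Y.1 s = X.1 s ∩ Set.Ici K)
      (fun d => (∀ s, Y.1 s ⊆ X.1 s) ∧ Silences d Y.1) i)
    ⟨fun _ => Set.univ, fun _ => Set.infinite_univ⟩
  refine ⟨M, hM, ⟨_, h₀⟩, fun X hX K => hcl (Sum.inl K) X hX ?_,
    fun X hX d hd => hcl (Sum.inr d) X hX ?_⟩
  · refine ⟨⟨fun s => X.1 s ∩ Set.Ici K, fun s => ?_⟩, fun s => rfl⟩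
    refine ((X.2 s).sdiff (Set.finite_lt_nat K)).mono fun x hx => ⟨hx.1, ?_⟩
    simpa using hx.2
  · obtain ⟨N, hN⟩ := hd
    exact exists_silences X d hN

/-- `f` admits splitting extensions whenever no reservoir silencing the functionals exists. -/
def GenericFor {n : ℕ} (f : ℕ → Fin 3) (M : Set (Reservoir n)) : Prop :=
  ∀ X ∈ M, ∀ d, (∃ N, ∀ h, ∃ y, (h, y) ∈ splitFree X.1 d N) ∨ f ∈ splitSet X.1 d

theorem exists_genericFor :
    ∃ f : ℕ → Fin 3, ∀ n, ∃ M : Set (Reservoir n), IsClosedFamily M ∧ GenericFor f M := by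
  classical
  choose M hMc hM using exists_isClosedFamily
  have := fun n => (hMc n).to_subtype
  let V : (Σ n, M n × Datum n) → Set (ℕ → Fin 3) := fun i =>
    if Dense (splitSet i.2.1.1.1 i.2.2) then splitSet i.2.1.1.1 i.2.2 else Set.univ
  have hdense : Dense (⋂ i, V i) := by
    refine dense_iInter_of_isOpen (fun i => ?_) fun i => ?_
    · by_cases h : Dense (splitSet i.2.1.1.1 i.2.2)
      · simpa only [V, if_pos h] using isOpen_splitSet _ _
      · simp only [V, if_neg h, isOpen_univ]
    · by_cases h : Dense (splitSet i.2.1.1.1 i.2.2)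
      · simpa only [V, if_pos h] using h
      · simp only [V, if_neg h, dense_univ]
  obtain ⟨f, hf⟩ := hdense.nonempty
  refine ⟨f, fun n => ⟨M n, hM n, fun X hX d => ?_⟩⟩
  by_cases hN : ∃ N, ∀ h, ∃ y, (h, y) ∈ splitFree X.1 d N
  · exact Or.inl hN
  · have h := dense_splitSet X.1 d (not_exists.1 hN)
    have := Set.mem_iInter.1 hf ⟨n, ⟨X, hX⟩, d⟩
    exact Or.inr (by simpa only [V, if_pos h] using this)

/-! ### Forcing homogeneous sets for a given tuple -/

section Forcing

variable {n : ℕ}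

/-- `X₀` decides the colors `b` of the components, and no smaller reservoir in `M` decides more. -/
structure IsDecider (g : Fin n → ℕ → Bool) (M : Set (Reservoir n)) (X₀ : Reservoir n)
    (b : Fin n → Option Bool) : Prop where
  mem : X₀ ∈ M
  decided : ∀ s β, b s = some β → ∀ x ∈ X₀.1 s, g s x = β
  undecided : ∀ Y ∈ M, (∀ s, Y.1 s ⊆ X₀.1 s) → ∀ s, b s = none → ∀ β K, ∃ x ∈ Y.1 s,
    K ≤ x ∧ g s x = β

/-- Maximize the number of decided components: if an undecided one missed a color beyond `K`, a tail
would decide it for the other color. -/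
theorem exists_isDecider (g : Fin n → ℕ → Bool) {M : Set (Reservoir n)} (hM : IsClosedFamily M) :
    ∃ X₀ b, IsDecider g M X₀ b := by
  classical
  let B : Set (Fin n → Option Bool) :=
    {b | ∃ X ∈ M, ∀ s β, b s = some β → ∀ x ∈ X.1 s, g s x = β}
  obtain ⟨X, hX⟩ := hM.nonempty
  have hB : B.Nonempty := ⟨fun _ => none, X, hX, by simp⟩
  obtain ⟨b, ⟨X₀, hX₀, hb⟩, hmax⟩ := B.toFinite.exists_maximalFor
    (fun b : Fin n → Option Bool => (Finset.univ.filter fun s => b s ≠ none).card) B hB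
  refine ⟨X₀, b, hX₀, hb, fun Y hY hsub s hs β K => ?_⟩
  by_contra hcon
  push Not at hcon
  obtain ⟨Z, hZ, hZY⟩ := hM.tail Y hY K
  have hmem : Function.update b s (some !β) ∈ B := by
    refine ⟨Z, hZ, fun t γ hγ x hx => ?_⟩
    rw [hZY] at hx
    by_cases hts : t = s
    · subst hts
      rw [Function.update_self, Option.some.injEq] at hγ
      rw [← hγ]
      exact Bool.eq_not.2 (hcon x hx.1 hx.2)
    · rw [Function.update_of_ne hts] at hγ
      exact hb t γ hγ x (hsub t hx.1)
  have hlt : (Finset.univ.filter fun t => b t ≠ none).card <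
      (Finset.univ.filter fun t => Function.update b s (some !β) t ≠ none).card := by
    refine Finset.card_lt_card (Finset.ssubset_iff_of_subset ?_ |>.2 ⟨s, by simp, by simp [hs]⟩)
    intro t ht
    by_cases hts : t = s
    · subst hts
      simp
    · simpa [Function.update_of_ne hts] using ht
  exact absurd (hmax hmem hlt.le) hlt.not_ge

/-- Forcing conditions: finite sets for every component and color, and a reservoir. -/
structure Condition (g : Fin n → ℕ → Bool) (M : Set (Reservoir n)) (X₀ : Reservoir n) where
  F : Fin n → Bool → Finset ℕ
  X : Reservoir n
  mem : X ∈ M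
  sub : ∀ s, X.1 s ⊆ X₀.1 s
  color : ∀ s β, ∀ x ∈ F s β, g s x = β

namespace Condition

variable {g : Fin n → ℕ → Bool} {M : Set (Reservoir n)} {X₀ : Reservoir n}

instance : Preorder (Condition g M X₀) where
  le c c' := (∀ s β, c.F s β ⊆ c'.F s β) ∧ (∀ s, c'.X.1 s ⊆ c.X.1 s) ∧
    ∀ s β, ∀ x ∈ c'.F s β, x ∈ c.F s β ∨ x ∈ c.X.1 s
  le_refl c := ⟨fun _ _ => subset_rfl, fun _ => subset_rfl, fun _ _ _ h => Or.inl h⟩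
  le_trans c c' c'' h h' := ⟨fun s β => (h.1 s β).trans (h'.1 s β),
    fun s => (h'.2.1 s).trans (h.2.1 s), fun s β x hx =>
      (h'.2.2 s β x hx).elim (h.2.2 s β x) fun hx => Or.inr (h.2.1 s hx)⟩

/-- The sets `G` are obtained from the finite part of `c` by adding elements of its reservoir. -/
def Admits (c : Condition g M X₀) (G : Fin n → Bool → Set ℕ) : Prop :=
  ∀ s β, (∀ x ∈ c.F s β, x ∈ G s β) ∧ ∀ x ∈ G s β, x ∈ c.F s β ∨ x ∈ c.X.1 s

/-- On some side, `c` prevents the functional from enumerating an infinite set of its color. -/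
def Prevents (c : Condition g M X₀) (f : ℕ → Fin 3) (b : Fin n → Option Bool)
    (r : (Fin n → Bool) → OracleCode × Fin 3) : Prop :=
  ∃ a, Compatible b a ∧ ∀ G, c.Admits G →
    {m | (r a).1.Enum (fun s => G s (a s)) m}.Infinite →
    ∃ m, (r a).1.Enum (fun s => G s (a s)) m ∧ f m ≠ (r a).2

theorem exists_le_prevents {f : ℕ → Fin 3} (hM : IsClosedFamily M) (hf : GenericFor f M)
    {b : Fin n → Option Bool} (hX₀ : IsDecider g M X₀ b)
    (r : (Fin n → Bool) → OracleCode × Fin 3) (c : Condition g M X₀) :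
    ∃ c', c'.Prevents f b r ∧ c ≤ c' := by
  classical
  rcases hf c.X c.mem (c.F, b, r) with hN | hsplit
  · obtain ⟨Y, hY, hsub, a, ha, N, hsil⟩ := hM.silence _ c.mem _ hN
    refine ⟨⟨c.F, Y, hY, fun s => (hsub s).trans (c.sub s), c.color⟩, ⟨a, ha, fun G hG hinf => ?_⟩,
      fun _ _ => subset_rfl, hsub, fun _ _ _ h => Or.inl h⟩
    exfalso
    obtain ⟨m, hm, hNm⟩ := hinf.exists_gt N
    obtain ⟨u, hu⟩ := hm.exists_use
    -- By the use principle, a late output from the infinite sets already comes from a finite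
    -- extension within the silencing reservoir.
    refine hsil (fun s => (Finset.range u).filter fun x => x ∈ Y.1 s ∧ x ∈ G s (a s))
      (fun s x hx => (Finset.mem_filter.1 hx).2.1) m hNm.le (hu _ fun s x hxu => ?_)
    simp only [Set.mem_union, Finset.mem_coe, Finset.mem_filter, Finset.mem_range]
    constructor
    · intro hx
      exact ((hG s (a s)).2 x hx).imp id fun hY => ⟨hxu, hY, hx⟩
    · rintro (hx | hx)
      · exact (hG s (a s)).1 x hx
      · exact hx.2.2
  · obtain ⟨a, ha, E, m, he, hE, hne⟩ : ∃ a, Compatible b a ∧ ∃ E : Fin n → Finset ℕ, ∃ m,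
        (r a).1.Enum (fun s => (c.F s (a s) : Set ℕ) ∪ E s) m ∧
        (∀ s, ∀ x ∈ E s, x ∈ c.X.1 s ∧ g s x = a s) ∧ f m ≠ (r a).2 := by
      by_contra hcon
      push Not at hcon
      -- `splitFree` wants decided components constant everywhere, but `g` is constant only on the
      -- reservoir. The corrected tuple agrees with `g` there, which is all that extensions see.
      refine hsplit ⟨fun s x => (b s).getD (g s x), fun s β hβ x => ?_,
        fun a ha E m _ he hE => hcon a ha E m he fun s x hx => ⟨(hE s x hx).1, ?_⟩⟩
      · change b s = some β at hβ
        simp [hβ]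
      · have hx' := (hE s x hx).2
        cases hb : b s with
        | none => simpa [hb] using hx'
        | some β =>
          rw [hX₀.decided s β hb x (c.sub s (hE s x hx).1)]
          exact (ha s β hb).symm
    obtain ⟨u, hu⟩ := he.exists_use
    -- Elements added later lie beyond the use `u` and so preserve the wrongly colored output.
    obtain ⟨Y, hY, hYX⟩ := hM.tail _ c.mem u
    have hYX' : ∀ s, Y.1 s ⊆ c.X.1 s := fun s x hx => by
      rw [hYX] at hx
      exact hx.1
    refine ⟨⟨fun s β => if β = a s then c.F s β ∪ E s else c.F s β, Y, hY,
      fun s => (hYX' s).trans (c.sub s), fun s β x hx => ?_⟩, ⟨a, ha, fun G hG _ => ?_⟩,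
      fun s β x hx => ?_, hYX', fun s β x hx => ?_⟩
    · split_ifs at hx with hβ
      · rcases Finset.mem_union.1 hx with hx | hx
        · exact c.color s β x hx
        · rw [hβ]
          exact (hE s x hx).2
      · exact c.color s β x hx
    · refine ⟨m, hu _ fun s x hxu => ?_, hne⟩
      have hGs := hG s (a s)
      simp only [if_true, Finset.mem_union] at hGs
      constructor
      · rintro (hx | hx)
        · exact hGs.1 x (Or.inl hx)
        · exact hGs.1 x (Or.inr hx)
      · intro hx
        rcases hGs.2 x hx with hx | hx
        · exact hx
        · rw [hYX] at hx
          exact absurd hx.2 (not_le.2 hxu)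
    · change x ∈ if β = a s then c.F s β ∪ E s else c.F s β
      split_ifs
      · exact Finset.mem_union_left _ hx
      · exact hx
    · change x ∈ (if β = a s then c.F s β ∪ E s else c.F s β) at hx
      split_ifs at hx
      · exact (Finset.mem_union.1 hx).imp id fun hx => (hE s x hx).1
      · exact Or.inl hx

theorem exists_le_large {b : Fin n → Option Bool} (hX₀ : IsDecider g M X₀ b) (s : Fin n) (β : Bool)
    (K : ℕ) (c : Condition g M X₀) :
    ∃ c', ((∀ γ, b s = some γ → β = γ) → ∃ x ∈ c'.F s β, K ≤ x) ∧ c ≤ c' := by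
  classical
  by_cases hb : ∀ γ, b s = some γ → β = γ
  · obtain ⟨x, hx, hK, hg⟩ : ∃ x ∈ c.X.1 s, K ≤ x ∧ g s x = β := by
      cases hs : b s with
      | none => exact hX₀.undecided _ c.mem c.sub s hs β K
      | some γ =>
        obtain ⟨x, hx, hK⟩ := (c.X.2 s).exists_gt K
        exact ⟨x, hx, hK.le, (hX₀.decided s γ hs x (c.sub s hx)).trans (hb γ hs).symm⟩
    refine ⟨⟨fun t γ => if t = s ∧ γ = β then insert x (c.F t γ) else c.F t γ, c.X, c.mem, c.sub,
      fun t γ z hz => ?_⟩, fun _ => ⟨x, by simp, hK⟩, fun t γ z hz => ?_, fun _ => subset_rfl,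
      fun t γ z hz => ?_⟩
    · split_ifs at hz with h
      · rcases Finset.mem_insert.1 hz with rfl | hz
        · rw [h.1, h.2, hg]
        · exact c.color t γ z hz
      · exact c.color t γ z hz
    · change z ∈ if t = s ∧ γ = β then insert x (c.F t γ) else c.F t γ
      split_ifs
      · exact Finset.mem_insert_of_mem hz
      · exact hz
    · change z ∈ (if t = s ∧ γ = β then insert x (c.F t γ) else c.F t γ) at hz
      split_ifs at hz with h
      · rcases Finset.mem_insert.1 hz with rfl | hz
        · exact Or.inr (h.1 ▸ hx)
        · exact Or.inl hz
      · exact Or.inl hz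
  · exact ⟨c, fun h => absurd h hb, le_rfl⟩

end Condition

/-- For a generic `3`-coloring `f` and every tuple of `2`-colorings, there are infinite
homogeneous sets from which no functional enumerates an infinite `f`-homogeneous set. -/
theorem exists_homogeneous_not_enum {f : ℕ → Fin 3} {M : Set (Reservoir n)}
    (hM : IsClosedFamily M) (hf : GenericFor f M) (g : Fin n → ℕ → Bool) :
    ∃ (a : Fin n → Bool) (H : Fin n → Set ℕ), (∀ s, (H s).Infinite ∧ ∀ x ∈ H s, g s x = a s) ∧
      ∀ (e : OracleCode) (i : Fin 3), {m | e.Enum H m}.Infinite → ∃ m, e.Enum H m ∧ f m ≠ i := by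
  obtain ⟨X₀, b, hX₀⟩ := exists_isDecider g hM
  obtain ⟨c, hmono, hmeet⟩ := exists_monotone_meeting
    (P := Condition g M X₀)
    (ι := ((Fin n → Bool) → OracleCode × Fin 3) ⊕ (Fin n × Bool × ℕ))
    ⟨fun _ _ => ∅, X₀, hX₀.mem, fun _ => subset_rfl, by simp⟩
    (Sum.elim (fun r => {c | c.Prevents f b r})
      fun i => {c | (∀ γ, b i.1 = some γ → i.2.1 = γ) → ∃ x ∈ c.F i.1 i.2.1, i.2.2 ≤ x})
    (by
      rintro (r | ⟨s, β, K⟩) c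
      · exact Condition.exists_le_prevents hM hf hX₀ r c
      · exact Condition.exists_le_large hX₀ s β K c)
  set G : Fin n → Bool → Set ℕ := fun s β => {x | ∃ k, x ∈ (c k).F s β} with hG
  have hadm : ∀ k, (c k).Admits G := by
    refine fun k s β => ⟨fun x hx => ⟨k, hx⟩, ?_⟩
    rintro x ⟨j, hx⟩
    rcases le_total j k with h | h
    · exact Or.inl ((hmono h).1 s β hx)
    · exact (hmono h).2.2 s β x hx
  have hinf : ∀ a, Compatible b a → ∀ s, (G s (a s)).Infinite ∧ ∀ x ∈ G s (a s), g s x = a s := by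
    refine fun a ha s => ⟨Set.infinite_of_not_bddAbove ?_, ?_⟩
    · rintro ⟨K, hK⟩
      obtain ⟨k, hk⟩ := hmeet (Sum.inr (s, a s, K + 1))
      obtain ⟨x, hx, hKx⟩ := hk (ha s)
      exact absurd (hK ⟨k, hx⟩) (not_le.2 hKx)
    · rintro x ⟨k, hx⟩
      exact (c k).color s _ x hx
  by_contra hcon
  push Not at hcon
  choose e i hei using fun a => show ∃ (e : OracleCode) (i : Fin 3), Compatible b a →
      {m | e.Enum (fun s => G s (a s)) m}.Infinite ∧
        ∀ m, e.Enum (fun s => G s (a s)) m → f m = i from by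
    by_cases ha : Compatible b a
    · obtain ⟨e, i, h⟩ := hcon a _ (hinf a ha)
      exact ⟨e, i, fun _ => h⟩
    · exact ⟨.zero, 0, fun h => absurd h ha⟩
  -- The supposed counterexamples for all sides are combined into one requirement, whose success on
  -- a single side is a contradiction.
  obtain ⟨k, a, ha, hk⟩ := hmeet (Sum.inl fun a => (e a, i a))
  obtain ⟨m, hm, hne⟩ := hk G (hadm k) (hei a ha).1
  exact hne ((hei a ha).2 m hm)

end Forcing

theorem mainTheorem9 :
    ¬ RamseyTypeProblem.StronglyOmniscientlyComputablyReducible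
        (RamseyTypeProblem.RT1 3) (RamseyTypeProblem.star (RamseyTypeProblem.RT1 2)) := by
  intro hred
  obtain ⟨f, hf⟩ := exists_genericFor
  obtain ⟨⟨n, g⟩, hg⟩ := hred f
  change Fin n → ℕ → Fin 2 at g
  obtain ⟨M, hM, hfM⟩ := hf n
  obtain ⟨a, H, hH, hne⟩ := exists_homogeneous_not_enum hM hfM fun s x => decide (g s x = 1)
  have hcol : ∀ s, ∀ x ∈ H s, g s x = if a s then 1 else 0 := by
    intro s x hx
    have := (hH s).2 x hx
    generalize g s x = v at this ⊢
    generalize a s = w at this ⊢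
    revert v w
    decide
  obtain ⟨A, ⟨hA, i, hi⟩, hcomp⟩ := hg (finJoin H) ⟨H, fun s => ⟨(hH s).1, _, hcol s⟩, rfl⟩
  obtain ⟨e, he⟩ := OracleCode.exists_enum_iff hcomp
  obtain ⟨m, hm, hmi⟩ := hne e i (by simpa only [he, Set.ofPred_mem_eq] using hA)
  exact hmi (hi m ((he m).1 hm))
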